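/- For a group $G$, let $G^\psi$ be a disjoint copy of $G$, with isomorphism $g\mapsto g^\psi$, and let $$X(G)=\langle G, G^\psi \mid [g,g^\psi]=1,\ g\in G\rangle,\qquad [x,y]=x^{-1}y^{-1}xy,$$ be its Sidki double, that is, the quotient of the free product $G*G^\psi$ by the normal closure of the elements $[g,g^\psi]$, $g\in G$. For a group $H$ with identity $e$ and a matrix $A=(a_{ij})\in M_n(\mathbb{C}H)$ with $a_{ij}=\sum_{h\in H}a_{ij}(h)\,h$, put $$\kappa(A)=\sum_{i=1}^n a_{ii}(e),\qquad \epsilon(A)=\sum_{h\in H}\sum_{i=1}^n a_{ii}(h).$$ Say that $\mathbb{C}H$ satisfies the weak Bass trace conjecture if $\kappa(A)=\epsilon(A)$ for every $n$ and every idempotent matrix $A=A^2\in M_n(\mathbb{C}H)$. **Proposition.** Let $G$ be a group whose Sidki double $X(G)$ is torsion-free (no element other than the identity has finite order). If $\mathbb{C}(G\times G\times G)$ satisfies the weak Bass trace conjecture, then $\mathbb{C}X(G)$ satisfies the weak Bass trace conjecture. -/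

import Mathlib

/-- The Sidki double `X(G) = ⟨G, G^ψ | [g, g^ψ], g ∈ G⟩`: the quotient of the free product `G ∗ G`
(the second factor being the copy `G^ψ` of `G`) by the normal closure of the commutators
`[g, g^ψ] = g⁻¹ (g^ψ)⁻¹ g g^ψ`, `g ∈ G`. -/
abbrev SidkiDouble (G : Type*) [Group G] : Type _ :=
  Monoid.Coprod G G ⧸ Subgroup.normalClosure
    (Set.range fun g : G =>
      (Monoid.Coprod.inl g)⁻¹ * (Monoid.Coprod.inr g)⁻¹ *
        Monoid.Coprod.inl g * (Monoid.Coprod.inr g : Monoid.Coprod G G))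

/-- A group is torsion-free if its only element of finite order is the identity. -/
def TorsionFreeGroup (H : Type*) [Group H] : Prop :=
  ∀ x : H, IsOfFinOrder x → x = 1

/-- The Kaplansky trace `κ(A) = ∑ i, a_ii(e)` of a square matrix over `ℂ H`. -/
noncomputable def kaplanskyTrace {H : Type*} [Group H] {n : ℕ}
    (A : Matrix (Fin n) (Fin n) (MonoidAlgebra ℂ H)) : ℂ :=
  ∑ i, (A i i).coeff 1

/-- The augmentation trace `ε(A) = ∑ h, ∑ i, a_ii(h)` of a square matrix over `ℂ H`. -/
noncomputable def augmentationTrace {H : Type*} [Group H] {n : ℕ}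
    (A : Matrix (Fin n) (Fin n) (MonoidAlgebra ℂ H)) : ℂ :=
  ∑ i, (A i i).coeff.sum fun _ c => c

/-- `ℂ H` satisfies the weak Bass trace conjecture: `κ(A) = ε(A)` for every idempotent matrix `A`,
of any size, over `ℂ H`. -/
def WeakBassTrace (H : Type*) [Group H] : Prop :=
  ∀ (n : ℕ) (A : Matrix (Fin n) (Fin n) (MonoidAlgebra ℂ H)),
    IsIdempotentElem A → kaplanskyTrace A = augmentationTrace A

/-! Let `φ : X(G) → G³` be `toProd`. The augmentation trace is unchanged by `φ`, while `κ(φ(A))` is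
the sum of the Hattori–Stallings trace of `A` over the conjugacy classes in `ker φ`. So it is enough
that no class of a `w ≠ 1` in `ker φ` contributes.

Two facts exclude such a `w`, after passing to a finitely generated subgroup containing the supports
of the entries. Arithmetic: reducing an idempotent modulo primes and using `A ^ p = A` shows that a
`w` in the support of the trace is conjugate to some `w ^ p ^ m`, `m > 0`, for infinitely many
primes `p` (`IsIdempotentElem.exists_isConj_prime_pow`). Group theory: `ker φ` lies in the subgroup
`D` generated by the `[g, h^ψ]` and in the subgroup `L` generated by the `k⁻¹ k^ψ`. Since `D` and
`L` commute, the centralizer of `ker φ` contains both, and the quotient by it is abelian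
(`SidkiDouble.commutator_le_centralizer`). Conjugation on the powers of `w` then depends only on
classes in a finitely generated abelian group, so only finitely many primes can be involved
independently. As `w` has infinite order, this is a contradiction
(`not_exists_conj_prime_pow_of_fg`). -/

/-! ### Traces of `p`-th powers in exponent `p` -/

theorem sum_eq_sum_fixed_of_pow_prime {α M : Type*} [Fintype α] [DecidableEq α] [AddCommMonoid M]
    {p : ℕ} [Fact p.Prime] (hM : ∀ m : M, p • m = 0) (σ : Equiv.Perm α) (hσ : σ ^ p = 1)
    (F : α → M) (hF : ∀ a, F (σ a) = F a) :
    ∑ a, F a = ∑ a with σ a = a, F a := by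
  classical
  rw [← Finset.sum_fiberwise_of_maps_to (s := Finset.univ) (t := Finset.univ.image F) (g := F)
    (by simp), ← Finset.sum_fiberwise_of_maps_to (s := Finset.univ.filter fun a => σ a = a)
    (t := Finset.univ.image F) (g := F) (by simp)]
  refine Finset.sum_congr rfl fun m _ => ?_
  rw [Finset.sum_congr rfl (g := fun _ => m) (by simp), Finset.sum_const,
    Finset.sum_congr rfl (g := fun _ => m) (by simp), Finset.sum_const]
  -- On each fibre of `F` only the cardinality modulo `p` matters, and `σ` acts there with orbits of
  -- size 1 or `p`.
  have hmod : ∀ a b : ℕ, a ≡ b [MOD p] → a • m = b • m := by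
    intro a b hab
    have key : ∀ c : ℕ, c • m = (c % p) • m := fun c => by
      conv_lhs => rw [← Nat.mod_add_div c p, add_smul, mul_comm, mul_smul, hM, smul_zero, add_zero]
    rw [key a, key b, hab]
  apply hmod
  let ρ : Equiv.Perm {a // F a = m} := σ.subtypePerm (fun a => by rw [hF])
  have hρ : ρ ^ p ^ 1 = 1 := by
    rw [pow_one, Equiv.Perm.subtypePerm_pow]
    ext x
    simp [hσ]
  have h := Equiv.Perm.card_compl_support_modEq hρ
  rw [Fintype.card_subtype] at h
  refine h.symm.trans ?_
  have : (ρ.supportᶜ).card = ({a ∈ {a | σ a = a} | F a = m} : Finset α).card := by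
    rw [← Finset.card_map (Function.Embedding.subtype _)]
    congr 1
    ext a
    simp only [Finset.mem_map, Finset.mem_compl, Equiv.Perm.mem_support, not_not,
      Function.Embedding.subtype_apply, Subtype.exists, Finset.mem_filter, Finset.mem_univ,
      true_and]
    constructor
    · rintro ⟨b, hb, h, rfl⟩
      exact ⟨congrArg Subtype.val h, hb⟩
    · rintro ⟨h1, h2⟩
      exact ⟨a, h2, Subtype.ext h1, rfl⟩
  rw [this]

theorem sum_pow_eq_sum_prod_ofFn {ι S : Type*} [Fintype ι] [Semiring S] (x : ι → S) (n : ℕ) :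
    (∑ i, x i) ^ n = ∑ f : Fin n → ι, (List.ofFn fun i => x (f i)).prod := by
  induction n with
  | zero => simp
  | succ n ih =>
    rw [pow_succ', ih, Finset.sum_mul_sum, ← Fintype.sum_prod_type',
      ← (Fin.consEquiv fun _ => ι).sum_comp]
    simp [List.ofFn_succ, Fin.consEquiv]

/-- A trace with values in a group of exponent `p` is compatible with `p`-th powers of sums. -/
theorem trace_sum_pow_prime {ι S M : Type*} [Fintype ι] [Semiring S] [AddCommMonoid M]
    {p : ℕ} [hp : Fact p.Prime] (hM : ∀ m : M, p • m = 0) (τ : S →+ M)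
    (hτ : ∀ a b, τ (a * b) = τ (b * a)) (x : ι → S) :
    τ ((∑ i, x i) ^ p) = ∑ i, τ (x i ^ p) := by
  classical
  rw [sum_pow_eq_sum_prod_ofFn, map_sum]
  -- Cyclic rotation of words of length `p`: the trace is invariant under it, and the fixed words
  -- are the constant ones, which give the `x i ^ p`.
  let σ : Equiv.Perm (Fin p → ι) := Equiv.arrowCongr (finRotate p).symm (Equiv.refl ι)
  have hσ : ∀ f, σ f = f ∘ finRotate p := fun f => rfl
  have hσk : ∀ (k : ℕ) f, (σ ^ k) f = f ∘ ⇑(finRotate p ^ k) := by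
    intro k
    induction k with
    | zero => intro f; rfl
    | succ k ih =>
      intro f
      rw [pow_succ, Equiv.Perm.mul_apply, ih, hσ, pow_succ', Equiv.Perm.coe_mul,
        Function.comp_assoc]
  have hrot : finRotate p ^ p = 1 := by
    have h := (isCycle_finRotate_of_le hp.out.two_le).orderOf
    rw [support_finRotate_of_le hp.out.two_le, Finset.card_univ, Fintype.card_fin] at h
    exact orderOf_dvd_iff_pow_eq_one.1 h.dvd
  rw [sum_eq_sum_fixed_of_pow_prime hM σ]
  · symm
    obtain ⟨n, rfl⟩ : ∃ n, p = n + 1 := ⟨p - 1, by have := hp.out.pos; omega⟩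
    refine Finset.sum_bij (fun i _ => fun _ => i) ?_ ?_ ?_ ?_
    · intro i _
      simp [hσ]
      rfl
    · intro i _ j _ h
      exact congrFun h 0
    · intro f hf
      have hf' := (Finset.mem_filter.1 hf).2
      refine ⟨f 0, Finset.mem_univ _, funext fun i => ?_⟩
      induction i using Fin.induction with
      | zero => rfl
      | succ i ih =>
        rw [ih]
        have := congrFun hf' i.castSucc
        rw [hσ, Function.comp_apply, finRotate_apply, Fin.coeSucc_eq_succ] at this
        exact this.symm
    · intro i _
      rw [List.ofFn_const, List.prod_replicate]
  · ext1 f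
    rw [hσk, hrot]
    rfl
  · intro f
    obtain ⟨n, rfl⟩ : ∃ n, p = n + 1 := ⟨p - 1, by have := hp.out.pos; omega⟩
    rw [List.ofFn_succ', List.ofFn_succ (f := fun i => x (f i)), List.concat_eq_append,
      List.prod_append, List.prod_cons, hτ]
    simp [hσ]

/-! ### The Hattori–Stallings trace and Frobenius -/

/-- The Hattori–Stallings trace of a square matrix over a group algebra, as a finitely supported
function on the conjugacy classes. -/
noncomputable def hattoriStallings {k H : Type*} [CommRing k] [Group H] {n : ℕ} :
    Matrix (Fin n) (Fin n) (MonoidAlgebra k H) →+ (ConjClasses H →₀ k) where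
  toFun A := ∑ i, Finsupp.mapDomain ConjClasses.mk (A i i).coeff
  map_zero' := by simp
  map_add' A B := by
    simp [MonoidAlgebra.coeff_add, Finsupp.mapDomain_add, Finset.sum_add_distrib]

section

variable {k H : Type*} [CommRing k] [Group H] {n : ℕ}

theorem hattoriStallings_apply (A : Matrix (Fin n) (Fin n) (MonoidAlgebra k H)) :
    hattoriStallings A = ∑ i, Finsupp.mapDomain ConjClasses.mk (A i i).coeff := rfl

theorem mapDomain_conjClassesMk_mul_comm (x y : MonoidAlgebra k H) :
    Finsupp.mapDomain ConjClasses.mk (x * y).coeff =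
      Finsupp.mapDomain ConjClasses.mk (y * x).coeff := by
  induction x using MonoidAlgebra.induction_linear with
  | zero => simp
  | add x₁ x₂ h₁ h₂ =>
    simp only [add_mul, mul_add, MonoidAlgebra.coeff_add, Finsupp.mapDomain_add, h₁, h₂]
  | single g a =>
    induction y using MonoidAlgebra.induction_linear with
    | zero => simp
    | add x₁ x₂ h₁ h₂ =>
      simp only [add_mul, mul_add, MonoidAlgebra.coeff_add, Finsupp.mapDomain_add, h₁, h₂]
    | single h b =>
      rw [MonoidAlgebra.single_mul_single, MonoidAlgebra.single_mul_single,
        MonoidAlgebra.coeff_single, MonoidAlgebra.coeff_single, Finsupp.mapDomain_single,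
        Finsupp.mapDomain_single, mul_comm b a]
      congr 1
      rw [ConjClasses.mk_eq_mk_iff_isConj, isConj_iff]
      exact ⟨g⁻¹, by group⟩

theorem hattoriStallings_mul_comm (A B : Matrix (Fin n) (Fin n) (MonoidAlgebra k H)) :
    hattoriStallings (A * B) = hattoriStallings (B * A) := by
  have h : ∀ x : Fin n → MonoidAlgebra k H, Finsupp.mapDomain ConjClasses.mk (∑ i, x i).coeff =
      ∑ i, Finsupp.mapDomain (M := k) ConjClasses.mk (x i).coeff := fun x => by
    rw [MonoidAlgebra.coeff_sum, Finsupp.mapDomain_finsetSum]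
  simp only [hattoriStallings_apply, Matrix.mul_apply, h]
  rw [Finset.sum_comm]
  simp only [mapDomain_conjClassesMk_mul_comm (A _ _)]

/-- The power map on conjugacy classes. -/
def ConjClasses.powMap (m : ℕ) : ConjClasses H → ConjClasses H :=
  Quotient.map (· ^ m) fun _ _ h => h.pow m

theorem ConjClasses.powMap_mk (m : ℕ) (g : H) :
    ConjClasses.powMap m (ConjClasses.mk g) = ConjClasses.mk (g ^ m) := rfl

theorem ConjClasses.powMap_iterate_mk (m j : ℕ) (g : H) :
    (ConjClasses.powMap m)^[j] (ConjClasses.mk g) = ConjClasses.mk (g ^ m ^ j) := by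
  induction j with
  | zero => simp
  | succ j ih => rw [Function.iterate_succ_apply', ih, powMap_mk, pow_succ, pow_mul]

theorem hattoriStallings_single_pow {p : ℕ} (hp : 2 ≤ p) (i j : Fin n) (g : H) (a : k) :
    hattoriStallings (Matrix.single i j (MonoidAlgebra.single g a) ^ p) =
      if i = j then Finsupp.single (ConjClasses.mk (g ^ p)) (a ^ p) else 0 := by
  split_ifs with h
  · subst h
    have : ∀ m : ℕ, Matrix.single i i (MonoidAlgebra.single g a) ^ (m + 1) =
        Matrix.single i i (MonoidAlgebra.single g a ^ (m + 1)) := fun m => by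
      induction m with
      | zero => simp
      | succ m ih => rw [pow_succ, ih, Matrix.single_mul_single_same, ← pow_succ]
    obtain ⟨m, rfl⟩ : ∃ m, p = m + 1 := ⟨p - 1, by omega⟩
    rw [this, MonoidAlgebra.single_pow, hattoriStallings_apply,
      Finset.sum_eq_single i (fun j _ hj => by simp [hj.symm])
        (by simp), Matrix.single_apply_same, MonoidAlgebra.coeff_single, Finsupp.mapDomain_single]
  · have : Matrix.single i j (MonoidAlgebra.single g a) ^ p = 0 :=
      pow_eq_zero_of_le hp (by
        rw [pow_two, Matrix.single_mul_single_of_ne]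
        exact fun h' => h h'.symm)
    rw [this, map_zero]

/-- Write `A` as a sum of matrices with one monomial entry and apply `trace_sum_pow_prime`; the
off-diagonal summands square to zero. -/
theorem hattoriStallings_pow_prime {p : ℕ} [hp : Fact p.Prime] [CharP k p]
    (A : Matrix (Fin n) (Fin n) (MonoidAlgebra k H)) :
    hattoriStallings (A ^ p) = Finsupp.mapDomain (ConjClasses.powMap p)
      (Finsupp.mapRange (frobenius k p) (map_zero _) (hattoriStallings A)) := by
  classical
  have hM : ∀ m : ConjClasses H →₀ k, p • m = 0 := fun m => by
    ext c
    simp [nsmul_eq_mul]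
  let s : Finset H := Finset.univ.biUnion fun i => Finset.univ.biUnion fun j =>
    (A i j).coeff.support
  have hs : ∀ i j, (A i j).coeff.support ⊆ s := fun i j g hg => by
    simp only [s, Finset.mem_biUnion, Finset.mem_univ, true_and]
    exact ⟨i, j, hg⟩
  have hsum : ∀ i j, A i j = ∑ g : s, MonoidAlgebra.single g.1 ((A i j).coeff g.1) := fun i j => by
    rw [Finset.sum_coe_sort s fun g => MonoidAlgebra.single g ((A i j).coeff g)]
    conv_lhs => rw [← MonoidAlgebra.sum_coeff_single (A i j)]
    exact Finsupp.sum_of_support_subset _ (hs i j) _ (by simp)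
  have hA : A = ∑ t : (Fin n × Fin n) × s,
      Matrix.single t.1.1 t.1.2 (MonoidAlgebra.single t.2.1 ((A t.1.1 t.1.2).coeff t.2.1)) := by
    rw [Fintype.sum_prod_type, Fintype.sum_prod_type]
    conv_lhs => rw [Matrix.matrix_eq_sum_single A]
    refine Finset.sum_congr rfl fun i _ => Finset.sum_congr rfl fun j _ => ?_
    conv_lhs => rw [hsum i j]
    exact map_sum (Matrix.singleAddMonoidHom i j) _ _
  conv_lhs => rw [hA]
  rw [trace_sum_pow_prime hM hattoriStallings hattoriStallings_mul_comm]
  simp only [hattoriStallings_single_pow hp.out.two_le]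
  rw [Fintype.sum_prod_type, Fintype.sum_prod_type]
  have hdiag : ∀ i, Finsupp.mapDomain ConjClasses.mk (A i i).coeff =
      ∑ g : s, Finsupp.single (ConjClasses.mk g.1) ((A i i).coeff g.1) := fun i => by
    conv_lhs => rw [hsum i i]
    rw [MonoidAlgebra.coeff_sum, Finsupp.mapDomain_finsetSum]
    simp [Finsupp.mapDomain_single]
  rw [hattoriStallings_apply]
  simp only [hdiag]
  change _ = Finsupp.mapDomain.addMonoidHom (ConjClasses.powMap p)
    (Finsupp.mapRange.addMonoidHom (frobenius k p).toAddMonoidHom _)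
  simp [Finsupp.mapDomain_single, ConjClasses.powMap_mk, frobenius_def]

/-- Over a domain of characteristic `p`, an element at which the Hattori–Stallings trace of an
idempotent matrix does not vanish is conjugate to one of its `p ^ m`-th powers, `m > 0`. -/
theorem IsIdempotentElem.exists_isConj_pow_of_charP [IsDomain k] {p : ℕ} [hp : Fact p.Prime]
    [CharP k p] {A : Matrix (Fin n) (Fin n) (MonoidAlgebra k H)} (hA : IsIdempotentElem A)
    {g : H} (hg : hattoriStallings A (ConjClasses.mk g) ≠ 0) :
    ∃ m, 0 < m ∧ IsConj g (g ^ p ^ m) := by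
  classical
  set t := hattoriStallings A with ht
  have key : t = Finsupp.mapDomain (ConjClasses.powMap p)
      (Finsupp.mapRange (frobenius k p) (map_zero _) t) := by
    rw [ht, ← hattoriStallings_pow_prime, hA.pow_eq hp.out.ne_zero]
  have hsub : t.support ⊆ t.support.image (ConjClasses.powMap p) := by
    conv_lhs => rw [key]
    exact Finsupp.mapDomain_support.trans (Finset.image_subset_image Finsupp.support_mapRange)
  -- A finite set contained in its image equals it, so the `p`-power map permutes the support and
  -- every class there is periodic.
  have heq : t.support = t.support.image (ConjClasses.powMap p) :=
    Finset.eq_of_subset_of_card_le hsub Finset.card_image_le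
  have hmaps : ∀ c ∈ t.support, ConjClasses.powMap p c ∈ t.support := fun c hc => by
    rw [heq]; exact Finset.mem_image_of_mem _ hc
  let f : t.support → t.support := fun c => ⟨ConjClasses.powMap p c, hmaps c c.2⟩
  have hf : Function.Surjective f := by
    rintro ⟨c, hc⟩
    have hc' := hc
    rw [heq] at hc'
    obtain ⟨d, hd, rfl⟩ := Finset.mem_image.1 hc'
    exact ⟨⟨d, hd⟩, rfl⟩
  obtain ⟨m, hm, hper⟩ := (Finite.injective_iff_surjective.2 hf).mem_periodicPts
    ⟨ConjClasses.mk g, Finsupp.mem_support_iff.2 hg⟩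
  refine ⟨m, hm, ?_⟩
  have hit : ∀ (j : ℕ) c, ((f^[j] c : t.support) : ConjClasses H) =
      (ConjClasses.powMap p)^[j] c := fun j => by
    induction j with
    | zero => intro c; rfl
    | succ j ih => intro c; rw [Function.iterate_succ_apply', Function.iterate_succ_apply', ← ih]
  have := congrArg Subtype.val hper
  rw [hit, ConjClasses.powMap_iterate_mk] at this
  exact (ConjClasses.mk_eq_mk_iff_isConj.1 this).symm

end

/-! ### Residue characteristics of finitely generated domains -/

theorem Int.isJacobsonRing : IsJacobsonRing ℤ := by
  refine isJacobsonRing_iff_prime_eq.2 fun P hP => ?_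
  by_cases h0 : P = ⊥
  · subst h0
    refine le_antisymm (fun x hx => ?_) Ideal.le_jacobson
    by_contra hx0
    obtain ⟨p, hpx, hp⟩ := Nat.exists_infinite_primes (x.natAbs + 1)
    have hmax : (Ideal.span {(p : ℤ)}).IsMaximal :=
      PrincipalIdealRing.isMaximal_of_irreducible (Nat.prime_iff_prime_int.1 hp).irreducible
    have := Ideal.mem_sInf.1 hx ⟨bot_le, hmax⟩
    rw [Ideal.mem_span_singleton, Int.natCast_dvd] at this
    have := Nat.le_of_dvd (Int.natAbs_pos.2 hx0) this
    omega
  · have := hP.isMaximal h0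
    exact Ideal.jacobson_eq_self_of_isMaximal

/-- By the Nullstellensatz over the Jacobson ring `ℤ`, `K` is finite over `ℤ`; in characteristic
zero integrality would make `ℤ` a field. -/
theorem Algebra.FiniteType.exists_prime_cast_eq_zero (K : Type*) [Field K] [Algebra ℤ K]
    [Algebra.FiniteType ℤ K] : ∃ p : ℕ, p.Prime ∧ (p : K) = 0 := by
  have := Int.isJacobsonRing
  have := finite_of_finite_type_of_isJacobsonRing ℤ K
  obtain ⟨p, hp⟩ := CharP.exists K
  refine ⟨p, (CharP.char_is_prime_or_zero K p).resolve_right ?_, CharP.cast_eq_zero _ _⟩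
  rintro rfl
  have : CharZero K := CharP.charP_to_charZero _
  exact Int.not_isField (isField_of_isIntegral_of_isField (R := ℤ) (S := K)
    (fun a b h => by simpa using h) (Field.toIsField _))

/-- Invert `r * N` and contract a maximal ideal: its residue field has positive characteristic `p`,
and both `r` and `N` stay nonzero in it. -/
theorem Algebra.FiniteType.exists_prime_mem_of_ne_zero {S : Type*} [CommRing S] [IsDomain S]
    [CharZero S] [Algebra.FiniteType ℤ S] {r : S} (hr : r ≠ 0) {N : ℕ} (hN : N ≠ 0) :
    ∃ p : ℕ, p.Prime ∧ ¬ p ∣ N ∧ ∃ P : Ideal S, P.IsPrime ∧ (p : S) ∈ P ∧ r ∉ P := by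
  have hrN : r * (N : S) ≠ 0 := mul_ne_zero hr (Nat.cast_ne_zero.2 hN)
  let B := Localization.Away (r * (N : S))
  have : Nontrivial B := (IsLocalization.injective B (powers_le_nonZeroDivisors_of_noZeroDivisors hrN)).nontrivial
  have : Algebra.FiniteType S B := IsLocalization.finiteType_of_monoid_fg (.powers (r * (N : S))) B
  have : Algebra.FiniteType ℤ B := Algebra.FiniteType.trans ‹Algebra.FiniteType ℤ S› this
  obtain ⟨m, hm⟩ := Ideal.exists_maximal B
  let _ : Field (B ⧸ m) := Ideal.Quotient.field m
  have : Algebra.FiniteType ℤ (B ⧸ m) := inferInstance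
  obtain ⟨p, hpp, hp⟩ := Algebra.FiniteType.exists_prime_cast_eq_zero (B ⧸ m)
  have hu : IsUnit (algebraMap S B (r * (N : S))) := IsLocalization.Away.algebraMap_isUnit _
  have hpm : ((p : ℕ) : B) ∈ m := by
    rw [← Ideal.Quotient.eq_zero_iff_mem, map_natCast]
    exact hp
  have hu' : algebraMap S B (r * (N : S)) ∉ m := fun h =>
    hm.ne_top (Ideal.eq_top_of_isUnit_mem _ h hu)
  refine ⟨p, hpp, ?_, m.comap (algebraMap S B), Ideal.IsPrime.comap _, ?_, ?_⟩
  · rintro ⟨d, rfl⟩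
    refine hu' ?_
    have : algebraMap S B (r * ((p * d : ℕ) : S)) = ((p : ℕ) : B) * algebraMap S B (r * d) := by
      rw [← map_natCast (algebraMap S B), ← map_mul]
      congr 1
      push_cast
      ring
    rw [this]
    exact m.mul_mem_right _ hpm
  · simpa using hpm
  · exact fun h => hu' (by rw [map_mul]; exact m.mul_mem_right _ h)

/-! ### Functoriality of the trace and reduction modulo `p` -/

section

variable {k k' H Q : Type*} [CommRing k] [CommRing k'] [Group H] [Group Q] {n : ℕ}

theorem hattoriStallings_map_mapRingHom (f : k →+* k')
    (A : Matrix (Fin n) (Fin n) (MonoidAlgebra k H)) (c : ConjClasses H) :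
    hattoriStallings (A.map (MonoidAlgebra.mapRingHom H f)) c = f (hattoriStallings A c) := by
  rw [hattoriStallings_apply, hattoriStallings_apply, Finsupp.finsetSum_apply,
    Finsupp.finsetSum_apply, map_sum]
  refine Finset.sum_congr rfl fun i _ => ?_
  rw [← Finsupp.mapRange_apply (hf := map_zero f), ← Finsupp.mapDomain_mapRange _ _ _ _ (map_add f)]
  congr 2

theorem hattoriStallings_map_mapDomainRingHom (φ : H →* Q)
    (A : Matrix (Fin n) (Fin n) (MonoidAlgebra k H)) :
    hattoriStallings (A.map (MonoidAlgebra.mapDomainRingHom k φ)) =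
      Finsupp.mapDomain (ConjClasses.map φ) (hattoriStallings A) := by
  rw [hattoriStallings_apply, hattoriStallings_apply, Finsupp.mapDomain_finsetSum]
  refine Finset.sum_congr rfl fun i _ => ?_
  rw [← Finsupp.mapDomain_comp, Matrix.map_apply, MonoidAlgebra.mapDomainRingHom_apply,
    MonoidAlgebra.coeff_mapDomain, ← Finsupp.mapDomain_comp]
  rfl

theorem IsIdempotentElem.of_map_injective {R S : Type*} [Semiring R] [Semiring S] (f : R →+* S)
    (hf : Function.Injective f) {A : Matrix (Fin n) (Fin n) R}
    (hA : IsIdempotentElem (A.map f)) : IsIdempotentElem A := by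
  have : Function.Injective (f.mapMatrix : Matrix (Fin n) (Fin n) R →+* _) :=
    Matrix.map_injective hf
  apply this
  rw [map_mul]
  exact hA

theorem IsIdempotentElem.matrix_map {R S : Type*} [Semiring R] [Semiring S] (f : R →+* S)
    {A : Matrix (Fin n) (Fin n) R} (hA : IsIdempotentElem A) : IsIdempotentElem (A.map f) :=
  hA.map (f.mapMatrix : Matrix (Fin n) (Fin n) R →+* _)

theorem Matrix.exists_map_eq_of_mem_range {R S : Type*} [Ring R] [Ring S] (f : R →+* S)
    (A : Matrix (Fin n) (Fin n) S) (h : ∀ i j, A i j ∈ f.range) :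
    ∃ A' : Matrix (Fin n) (Fin n) R, A'.map f = A := by
  choose A' hA' using h
  exact ⟨Matrix.of A', Matrix.ext hA'⟩

end

/-- If the Hattori–Stallings trace of an idempotent complex matrix does not vanish at `g`, then
for infinitely many primes `p`, the element `g` is conjugate to a proper `p`-power of itself. -/
theorem IsIdempotentElem.exists_isConj_prime_pow {H : Type*} [Group H] {n : ℕ}
    {A : Matrix (Fin n) (Fin n) (MonoidAlgebra ℂ H)} (hA : IsIdempotentElem A) {g : H}
    (hg : hattoriStallings A (ConjClasses.mk g) ≠ 0) {N : ℕ} (hN : N ≠ 0) :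
    ∃ p : ℕ, p.Prime ∧ ¬ p ∣ N ∧ ∃ m, 0 < m ∧ IsConj g (g ^ p ^ m) := by
  classical
  let s : Finset ℂ := Finset.univ.biUnion fun i => Finset.univ.biUnion fun j =>
    (A i j).coeff.support.image (A i j).coeff
  -- `A` is defined over the ring generated by its finitely many coefficients, a finitely generated
  -- domain of characteristic zero.
  let R := Algebra.adjoin ℤ (s : Set ℂ)
  have hs : ∀ i j, ∀ h ∈ (A i j).coeff.support, (A i j).coeff h ∈ R := fun i j h hh => by
    refine Algebra.subset_adjoin ?_
    simp only [s, Finset.coe_biUnion, Set.mem_iUnion, Finset.mem_coe, Finset.mem_univ]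
    exact ⟨i, trivial, j, trivial, Finset.mem_image_of_mem _ hh⟩
  let ι : R →+* ℂ := R.val
  have hι : Function.Injective ι := Subtype.val_injective
  have : Algebra.FiniteType ℤ R := R.fg_iff_finiteType.1 ⟨s, rfl⟩
  obtain ⟨B, hBA⟩ := Matrix.exists_map_eq_of_mem_range (MonoidAlgebra.mapRingHom H ι) A
    fun i j => by
      rw [← MonoidAlgebra.sum_coeff_single (A i j)]
      refine sum_mem fun h hh => ⟨MonoidAlgebra.single h ⟨_, hs i j h hh⟩, ?_⟩
      simp [ι]
  rw [← hBA] at hA hg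
  have hB : IsIdempotentElem B := hA.of_map_injective _ (by
    intro x y hxy
    rw [← MonoidAlgebra.coeff_inj] at hxy ⊢
    exact Finsupp.mapRange_injective ι (map_zero ι) hι hxy)
  rw [hattoriStallings_map_mapRingHom] at hg
  have hr : hattoriStallings B (ConjClasses.mk g) ≠ 0 := fun h => hg (by rw [h, map_zero])
  -- Reduction modulo `P` keeps the trace at `g` nonzero, so the characteristic `p` result applies
  -- over `R ⧸ P`.
  obtain ⟨p, hp, hpN, P, hP, hpP, hrP⟩ := Algebra.FiniteType.exists_prime_mem_of_ne_zero hr hN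
  have : Fact p.Prime := ⟨hp⟩
  have : CharP (R ⧸ P) p := by
    refine (CharP.charP_iff_prime_eq_zero hp).2 ?_
    rw [← map_natCast (Ideal.Quotient.mk P)]
    exact Ideal.Quotient.eq_zero_iff_mem.2 hpP
  refine ⟨p, hp, hpN, (hB.matrix_map (MonoidAlgebra.mapRingHom H
    (Ideal.Quotient.mk P))).exists_isConj_pow_of_charP (p := p) ?_⟩
  rw [hattoriStallings_map_mapRingHom]
  exact fun h => hrP (Ideal.Quotient.eq_zero_iff_mem.1 h)

/-! ### Elements conjugate to their prime powers -/

/-- The elements acting on the rational multiples of `w` by fractions of numbers prime to `q`. -/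
def commensurator {H : Type*} [Group H] (w : H) (q : ℕ) (hq : q.Prime) : Subgroup H where
  carrier := {h | ∃ a b : ℤ, ¬ (q : ℤ) ∣ a ∧ ¬ (q : ℤ) ∣ b ∧ h * w ^ a * h⁻¹ = w ^ b}
  one_mem' := by
    have : ¬ (q : ℤ) ∣ 1 := by exact_mod_cast hq.not_dvd_one
    exact ⟨1, 1, this, this, by simp⟩
  mul_mem' := by
    rintro h k ⟨a, b, ha, hb, hab⟩ ⟨c, d, hc, hd, hcd⟩
    have hq' := Nat.prime_iff_prime_int.1 hq
    refine ⟨c * a, b * d, hq'.not_dvd_mul hc ha, hq'.not_dvd_mul hb hd, ?_⟩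
    calc h * k * w ^ (c * a) * (h * k)⁻¹ = h * (k * w ^ c * k⁻¹) ^ a * h⁻¹ := by
          rw [zpow_mul, conj_zpow]; group
      _ = (h * w ^ a * h⁻¹) ^ d := by
          rw [hcd, ← zpow_mul, conj_zpow, ← zpow_mul, mul_comm]
      _ = w ^ (b * d) := by rw [hab, ← zpow_mul]
  inv_mem' := by
    rintro h ⟨a, b, ha, hb, hab⟩
    exact ⟨b, a, hb, ha, by rw [← hab]; group⟩

/-- If `w` has infinite order and commutes with all commutators of a finitely generated group,
then it is not conjugate to proper `p`-powers of itself for infinitely many primes `p`. -/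
theorem not_exists_conj_prime_pow_of_fg {H : Type*} [Group H] [hH : Group.FG H] {w : H}
    (hw : ¬ IsOfFinOrder w) (hc : ∀ c ∈ commutator H, Commute w c)
    (h : ∀ N : ℕ, N ≠ 0 → ∃ p : ℕ, p.Prime ∧ ¬ p ∣ N ∧ ∃ m, 0 < m ∧ IsConj w (w ^ p ^ m)) :
    False := by
  let I := {p : ℕ // p.Prime ∧ ∃ m, 0 < m ∧ IsConj w (w ^ p ^ m)}
  have hI : ∀ p : I, ∃ x : H, ∃ m, 0 < m ∧ x * w * x⁻¹ = w ^ p.1 ^ m := by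
    rintro ⟨p, hp, m, hm, hconj⟩
    obtain ⟨x, hx⟩ := isConj_iff.1 hconj
    exact ⟨x, m, hm, hx⟩
  choose x m hm hx using hI
  let y : I → Additive (Abelianization H) := fun p => Additive.ofMul (Abelianization.of (x p))
  have : AddGroup.FG (Additive (Abelianization H)) := by
    have : Group.FG (Abelianization H) := Group.fg_of_surjective (f := Abelianization.of) (QuotientGroup.mk'_surjective _)
    infer_instance
  have : Module.Finite ℤ (Additive (Abelianization H)) := Module.Finite.iff_addGroup_fg.2 this
  have hfg : (Submodule.span ℤ (Set.range y)).FG := IsNoetherian.noetherian _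
  obtain ⟨T, hT, hTspan⟩ := Submodule.fg_span_iff_fg_span_finset_subset _ |>.1 hfg
  classical
  have hT' : ∀ t ∈ T, ∃ p : I, y p = t := fun t ht => hT ht
  choose i hi using hT'
  -- Finitely many conjugators `x p` generate the span of all of them in the abelianization; `q` is
  -- chosen different from their primes.
  obtain ⟨q, hq, hqN, mq, hmq, hconj⟩ := h (∏ t ∈ T.attach, (i t.1 t.2).1)
    (Finset.prod_ne_zero_iff.2 fun t _ => (i t.1 t.2).2.1.ne_zero)
  let Q : I := ⟨q, hq, mq, hmq, hconj⟩
  have hq' := Nat.prime_iff_prime_int.1 hq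
  have h1 : ¬ (q : ℤ) ∣ 1 := by exact_mod_cast hq.not_dvd_one
  have hcomm : commutator H ≤ commensurator w q hq := fun c hcc =>
    ⟨1, 1, h1, h1, by rw [zpow_one, ← (hc c hcc).eq, mul_inv_cancel_right]⟩
  -- Modulo commutators, `x Q` is a product of powers of the chosen `x p`. These multiply exponents
  -- by powers of `p ≠ q`, and commutators fix `w`.
  have hmem : x Q ∈ commensurator w q hq := by
    have hle : Submodule.span ℤ (T : Set (Additive (Abelianization H))) ≤
        AddSubgroup.toIntSubmodule
          (Subgroup.toAddSubgroup ((commensurator w q hq).map Abelianization.of)) := by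
      rw [Submodule.span_le]
      intro t ht
      have hxi : x (i t ht) ∈ commensurator w q hq := by
        refine ⟨1, (((i t ht).1 : ℕ) ^ m (i t ht) : ℕ), h1, ?_, ?_⟩
        · rw [Int.natCast_dvd_natCast]
          intro hd
          have := hq.dvd_of_dvd_pow hd
          exact hqN (this.trans (Finset.dvd_prod_of_mem (fun t : T => (i t.1 t.2).1)
            (Finset.mem_attach T ⟨t, ht⟩)))
        · rw [zpow_one, zpow_natCast, hx]
      rw [← hi t ht]
      exact ⟨_, hxi, rfl⟩
    have hyQ : y Q ∈ Submodule.span ℤ (T : Set (Additive (Abelianization H))) := by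
      rw [← hTspan]
      exact Submodule.subset_span ⟨Q, rfl⟩
    obtain ⟨z, hz, hzx⟩ := hle hyQ
    have hzx' : Abelianization.of z = Abelianization.of (x Q) := hzx
    have : z⁻¹ * x Q ∈ commutator H := by
      rw [← Abelianization.ker_of, MonoidHom.mem_ker, map_mul, map_inv, hzx', inv_mul_cancel]
    have := (commensurator w q hq).mul_mem hz (hcomm this)
    rwa [mul_inv_cancel_left] at this
  obtain ⟨a, b, -, hb, hab⟩ := hmem
  -- Now `w ^ (q ^ m * a) = w ^ b` with `q ∤ b`, impossible for `w` of infinite order.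
  rw [← conj_zpow, hx, ← zpow_natCast, ← zpow_mul] at hab
  have := injective_zpow_iff_not_isOfFinOrder.2 hw hab
  refine hb (this ▸ Dvd.dvd.mul_right ?_ _)
  rw [Int.natCast_dvd_natCast]
  exact dvd_pow_self q (hm Q).ne'

/-! ### Structure of the Sidki double -/

namespace SidkiDouble

open Monoid (Coprod)

variable {G : Type*} [Group G]

/-- The canonical map of `G` to its Sidki double. -/
def inl : G →* SidkiDouble G := (QuotientGroup.mk' _).comp Coprod.inl

/-- The map `g ↦ g^ψ` of `G` to its Sidki double. -/
def inr : G →* SidkiDouble G := (QuotientGroup.mk' _).comp Coprod.inr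

theorem commute_inl_inr (g : G) : Commute (inl g) (inr g : SidkiDouble G) := by
  have h : (QuotientGroup.mk' _ ((Coprod.inl g)⁻¹ * (Coprod.inr g)⁻¹ *
      Coprod.inl g * (Coprod.inr g : Coprod G G)) : SidkiDouble G) = 1 :=
    (QuotientGroup.eq_one_iff _).2 (Subgroup.subset_normalClosure ⟨g, rfl⟩)
  simp only [map_mul, map_inv] at h
  change (inl g)⁻¹ * (inr g)⁻¹ * inl g * inr g = 1 at h
  rw [Commute, SemiconjBy]
  calc inl g * inr g = inr g * inl g * ((inl g)⁻¹ * (inr g)⁻¹ * inl g * inr g) := by group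
    _ = inr g * inl g := by rw [h, mul_one]

@[elab_as_elim]
theorem induction_on {motive : SidkiDouble G → Prop} (x : SidkiDouble G) (one : motive 1)
    (inl_mul : ∀ g x, motive x → motive (inl g * x))
    (inr_mul : ∀ g x, motive x → motive (inr g * x)) : motive x := by
  obtain ⟨x, rfl⟩ := QuotientGroup.mk'_surjective _ x
  induction x using Coprod.induction_on' with
  | one => exact one
  | inl_mul g x h => rw [map_mul]; exact inl_mul g _ h
  | inr_mul g x h => rw [map_mul]; exact inr_mul g _ h

/-- The homomorphism on the Sidki double given by commuting pairs of images. -/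
def lift {K : Type*} [Group K] (f₁ f₂ : G →* K) (h : ∀ g, Commute (f₁ g) (f₂ g)) :
    SidkiDouble G →* K :=
  QuotientGroup.lift _ (Coprod.lift f₁ f₂) (by
    intro x hx
    revert x
    change _ ≤ (Coprod.lift f₁ f₂).ker
    refine Subgroup.normalClosure_le_normal ?_
    rintro _ ⟨g, rfl⟩
    simp only [SetLike.mem_coe, MonoidHom.mem_ker, map_mul, map_inv, Coprod.lift_apply_inl,
      Coprod.lift_apply_inr]
    rw [mul_assoc, (h g).eq]
    group)

theorem lift_inl {K : Type*} [Group K] (f₁ f₂ : G →* K) (h : ∀ g, Commute (f₁ g) (f₂ g)) (g : G) :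
    lift f₁ f₂ h (inl g) = f₁ g := by
  change Coprod.lift f₁ f₂ (Coprod.inl g) = _
  simp

theorem lift_inr {K : Type*} [Group K] (f₁ f₂ : G →* K) (h : ∀ g, Commute (f₁ g) (f₂ g)) (g : G) :
    lift f₁ f₂ h (inr g) = f₂ g := by
  change Coprod.lift f₁ f₂ (Coprod.inr g) = _
  simp

/-- The commutator `[g, h^ψ]`. -/
def comm (g h : G) : SidkiDouble G := (inl g)⁻¹ * (inr h)⁻¹ * inl g * inr h

/-- The quotient `k⁻¹ k^ψ`. -/
def diff (k : G) : SidkiDouble G := (inl k)⁻¹ * inr k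

/-- The relation `[ab, AB] = 1` is symmetric under exchanging `a, b` with `A, B`; this is the source
of Sidki's symmetry. -/
theorem _root_.conj_commutator_eq_of_commute {K : Type*} [Group K] {a b A B : K}
    (ha : Commute a A) (hb : Commute b B) (hab : Commute (a * b) (A * B)) :
    b⁻¹ * (a⁻¹ * B⁻¹ * a * B) * b = B⁻¹ * (A⁻¹ * b⁻¹ * A * b) * B := by
  calc b⁻¹ * (a⁻¹ * B⁻¹ * a * B) * b = b⁻¹ * a⁻¹ * B⁻¹ * a * (B * b) := by group
    _ = (a * b)⁻¹ * (A * B)⁻¹ * (A * a) * b * B := by rw [← hb.eq]; group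
    _ = (A * B)⁻¹ * (a * b)⁻¹ * (a * A) * b * B := by rw [hab.inv_inv.eq, ha.eq]
    _ = B⁻¹ * (A⁻¹ * b⁻¹ * A * b) * B := by group

/-- Sidki's symmetry `[g, h^ψ] = [g^ψ, h]`. -/
theorem comm_eq (g h : G) : comm g h = (inr g)⁻¹ * (inl h)⁻¹ * inr g * inl h := by
  have hh := (commute_inl_inr h).eq
  -- Taking `h g h⁻¹` in place of `g` cancels the outer conjugations on `g`; those left act on `h`
  -- and `h^ψ`, which commute.
  have key := conj_commutator_eq_of_commute (commute_inl_inr (h * g * h⁻¹)) (commute_inl_inr h)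
    (by rw [← map_mul, ← map_mul]; exact commute_inl_inr _)
  have e1 : (inl h)⁻¹ * (inr h)⁻¹ * inl h = (inr h : SidkiDouble G)⁻¹ := by
    rw [(commute_inl_inr h).inv_inv.eq, inv_mul_cancel_right]
  have e2 : (inl h)⁻¹ * inr h * inl h = (inr h : SidkiDouble G) := by
    rw [mul_assoc, ← hh, inv_mul_cancel_left]
  have e3 : (inr h)⁻¹ * (inl h)⁻¹ * inr h = (inl h : SidkiDouble G)⁻¹ := by
    rw [(commute_inl_inr h).inv_inv.eq.symm, inv_mul_cancel_right]
  have e4 : (inr h)⁻¹ * inl h * inr h = (inl h : SidkiDouble G) := by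
    rw [mul_assoc, hh, inv_mul_cancel_left]
  simp only [map_mul, map_inv] at key
  calc comm g h = (inl g)⁻¹ * ((inl h)⁻¹ * (inr h)⁻¹ * inl h) * inl g *
        ((inl h)⁻¹ * inr h * inl h) := by rw [e1, e2, comm]
    _ = (inr g)⁻¹ * ((inr h)⁻¹ * (inl h)⁻¹ * inr h) * inr g *
        ((inr h)⁻¹ * inl h * inr h) := by
      refine Eq.trans ?_ (key.trans ?_) <;> group
    _ = _ := by rw [e3, e4]

/-- Expanding `[g, (hk)^ψ]` directly and through the symmetric form `[g^ψ, hk]` shows that `k` and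
`k^ψ` conjugate `[g, h^ψ]` identically. -/
theorem commute_comm_diff (g h k : G) : Commute (comm g h) (diff k) := by
  have h1 : comm g (h * k) = comm g k * ((inr k)⁻¹ * comm g h * inr k) := by
    simp only [comm, map_mul]
    group
  have h2 : comm g (h * k) = comm g k * ((inl k)⁻¹ * comm g h * inl k) := by
    simp only [comm_eq, map_mul]
    group
  have h3 := mul_left_cancel (h1.symm.trans h2)
  rw [Commute, SemiconjBy, diff]
  calc comm g h * ((inl k)⁻¹ * inr k) = inl k⁻¹ * inl k * comm g h * (inl k)⁻¹ * inr k := by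
        rw [← map_mul, inv_mul_cancel, map_one]; group
    _ = (inl k)⁻¹ * inr k * ((inr k)⁻¹ * (inl k * comm g h * (inl k)⁻¹) * inr k) := by
        rw [map_inv]; group
    _ = (inl k)⁻¹ * inr k * comm g h := by
        congr 1
        have h4 : comm g (h * k⁻¹) = comm g k⁻¹ * ((inr k) * comm g h * (inr k)⁻¹) := by
          simp only [comm, map_mul, map_inv]
          group
        have h5 : comm g (h * k⁻¹) = comm g k⁻¹ * ((inl k) * comm g h * (inl k)⁻¹) := by
          simp only [comm_eq, map_mul, map_inv]
          group
        rw [← mul_left_cancel (h4.symm.trans h5)]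
        group

theorem conj_mem_closure {K : Type*} [Group K] {s : Set K} {c : K}
    (h : ∀ x ∈ s, c * x * c⁻¹ ∈ Subgroup.closure s) {y : K} (hy : y ∈ Subgroup.closure s) :
    c * y * c⁻¹ ∈ Subgroup.closure s := by
  have : Subgroup.closure s ≤ (Subgroup.closure s).comap (MulAut.conj c).toMonoidHom :=
    (Subgroup.closure_le _).2 h
  exact this hy

/-- The subgroup generated by the commutators `[g, h^ψ]`. -/
def commSubgroup (G : Type*) [Group G] : Subgroup (SidkiDouble G) :=
  Subgroup.closure (Set.range fun t : G × G => comm t.1 t.2)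

/-- The subgroup generated by the quotients `k⁻¹ k^ψ`. -/
def diffSubgroup (G : Type*) [Group G] : Subgroup (SidkiDouble G) :=
  Subgroup.closure (Set.range diff)

theorem comm_mem (g h : G) : comm g h ∈ commSubgroup G := Subgroup.subset_closure ⟨(g, h), rfl⟩

theorem diff_mem (k : G) : diff k ∈ diffSubgroup G := Subgroup.subset_closure ⟨k, rfl⟩

theorem inl_conj_mem_commSubgroup (k : G) {x : SidkiDouble G} (hx : x ∈ commSubgroup G) :
    inl k * x * (inl k)⁻¹ ∈ commSubgroup G := by
  refine conj_mem_closure ?_ hx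
  rintro _ ⟨⟨g, h⟩, rfl⟩
  have : inl k * comm g h * (inl k)⁻¹ = comm (g * k⁻¹) h * (comm k⁻¹ h)⁻¹ := by
    simp only [comm, map_mul, map_inv]
    group
  exact this ▸ mul_mem (comm_mem _ _) (inv_mem (comm_mem _ _))

theorem inr_conj_mem_commSubgroup (k : G) {x : SidkiDouble G} (hx : x ∈ commSubgroup G) :
    inr k * x * (inr k)⁻¹ ∈ commSubgroup G := by
  refine conj_mem_closure ?_ hx
  rintro _ ⟨⟨g, h⟩, rfl⟩
  have : inr k * comm g h * (inr k)⁻¹ = (comm g k⁻¹)⁻¹ * comm g (h * k⁻¹) := by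
    simp only [comm, map_mul, map_inv]
    group
  exact this ▸ mul_mem (inv_mem (comm_mem _ _)) (comm_mem _ _)

theorem inl_conj_mem_diffSubgroup (k : G) {x : SidkiDouble G} (hx : x ∈ diffSubgroup G) :
    inl k * x * (inl k)⁻¹ ∈ diffSubgroup G := by
  refine conj_mem_closure ?_ hx
  rintro _ ⟨h, rfl⟩
  have : inl k * diff h * (inl k)⁻¹ = diff (h * k⁻¹) * (diff k⁻¹)⁻¹ := by
    simp only [diff, map_mul, map_inv]
    group
  exact this ▸ mul_mem (diff_mem _) (inv_mem (diff_mem _))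

theorem exists_eq_mul_inl_mul_inr (x : SidkiDouble G) :
    ∃ d ∈ commSubgroup G, ∃ a b, x = d * inl a * inr b := by
  induction x using induction_on with
  | one => exact ⟨1, one_mem _, 1, 1, by simp⟩
  | inl_mul k x h =>
    obtain ⟨d, hd, a, b, rfl⟩ := h
    exact ⟨_, inl_conj_mem_commSubgroup k hd, k * a, b, by rw [map_mul]; group⟩
  | inr_mul k x h =>
    obtain ⟨d, hd, a, b, rfl⟩ := h
    refine ⟨_, mul_mem (inr_conj_mem_commSubgroup k hd) (inv_mem (comm_mem a⁻¹ k⁻¹)),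
      a, k * b, ?_⟩
    simp only [comm, map_mul, map_inv]
    group

theorem exists_eq_mul_inl (x : SidkiDouble G) : ∃ l ∈ diffSubgroup G, ∃ a, x = l * inl a := by
  induction x using induction_on with
  | one => exact ⟨1, one_mem _, 1, by simp⟩
  | inl_mul k x h =>
    obtain ⟨l, hl, a, rfl⟩ := h
    exact ⟨_, inl_conj_mem_diffSubgroup k hl, k * a, by rw [map_mul]; group⟩
  | inr_mul k x h =>
    obtain ⟨l, hl, a, rfl⟩ := h
    refine ⟨_, inl_conj_mem_diffSubgroup k (mul_mem (diff_mem k) hl), k * a, ?_⟩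
    simp only [diff, map_mul]
    group

/-- The map `g ↦ (g, g, 1)`, `g^ψ ↦ (1, g, g)`. -/
def toProd (G : Type*) [Group G] : SidkiDouble G →* G × G × G :=
  lift ((MonoidHom.id G).prod ((MonoidHom.id G).prod 1))
    ((1 : G →* G).prod ((MonoidHom.id G).prod (MonoidHom.id G))) fun g => by
      simp [Commute, SemiconjBy]

theorem toProd_inl (g : G) : toProd G (inl g) = (g, g, 1) := lift_inl _ _ _ g

theorem toProd_inr (g : G) : toProd G (inr g) = (1, g, g) := lift_inr _ _ _ g

theorem toProd_comm (g h : G) : (toProd G (comm g h)).1 = 1 ∧ (toProd G (comm g h)).2.2 = 1 := by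
  simp [comm, toProd_inl, toProd_inr]

theorem toProd_diff (k : G) : (toProd G (diff k)).2.1 = 1 := by
  simp [diff, toProd_inl, toProd_inr]

/-- In `x = d · a · b^ψ` the factor `d` has trivial outer coordinates, so these coordinates of the
image of `x` are `a` and `b`. -/
theorem ker_toProd_le_commSubgroup : (toProd G).ker ≤ commSubgroup G := by
  intro x hx
  obtain ⟨d, hd, a, b, rfl⟩ := exists_eq_mul_inl_mul_inr x
  have hd1 : commSubgroup G ≤ ((MonoidHom.fst G (G × G)).comp (toProd G)).ker := by
    refine (Subgroup.closure_le _).2 ?_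
    rintro _ ⟨⟨g, h⟩, rfl⟩
    exact (toProd_comm g h).1
  have hd2 : commSubgroup G ≤
      (((MonoidHom.snd G G).comp (MonoidHom.snd G (G × G))).comp (toProd G)).ker := by
    refine (Subgroup.closure_le _).2 ?_
    rintro _ ⟨⟨g, h⟩, rfl⟩
    exact (toProd_comm g h).2
  have h1 : (toProd G d).1 = 1 := hd1 hd
  have h2 : (toProd G d).2.2 = 1 := hd2 hd
  rw [MonoidHom.mem_ker, map_mul, map_mul, toProd_inl, toProd_inr] at hx
  have ha := congrArg Prod.fst hx
  have hb := congrArg (fun t => t.2.2) hx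
  simp [h1, h2] at ha hb
  simpa [ha, hb] using hd

/-- In `x = l · a` the factor `l` has trivial middle coordinate, so that coordinate of the image of
`x` is `a`. -/
theorem ker_toProd_le_diffSubgroup : (toProd G).ker ≤ diffSubgroup G := by
  intro x hx
  obtain ⟨l, hl, a, rfl⟩ := exists_eq_mul_inl x
  have hl1 : diffSubgroup G ≤
      (((MonoidHom.fst G G).comp (MonoidHom.snd G (G × G))).comp (toProd G)).ker := by
    refine (Subgroup.closure_le _).2 ?_
    rintro _ ⟨k, rfl⟩
    exact toProd_diff k
  have h1 : (toProd G l).2.1 = 1 := hl1 hl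
  rw [MonoidHom.mem_ker, map_mul, toProd_inl] at hx
  have ha := congrArg (fun t => t.2.1) hx
  simp [h1] at ha
  simpa [ha] using hl

theorem commute_of_mem {x y : SidkiDouble G} (hx : x ∈ commSubgroup G)
    (hy : y ∈ diffSubgroup G) : Commute x y := by
  have h1 : commSubgroup G ≤ Subgroup.centralizer (Set.range diff) := by
    refine (Subgroup.closure_le _).2 ?_
    rintro _ ⟨⟨g, h⟩, rfl⟩
    rw [SetLike.mem_coe, Subgroup.mem_centralizer_iff]
    rintro _ ⟨k, rfl⟩
    exact (commute_comm_diff g h k).symm.eq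
  have h2 : diffSubgroup G ≤ Subgroup.centralizer {x} := by
    refine (Subgroup.closure_le _).2 ?_
    rintro _ ⟨k, rfl⟩
    rw [SetLike.mem_coe, Subgroup.mem_centralizer_singleton_iff]
    exact Subgroup.mem_centralizer_iff.1 (h1 hx) _ ⟨k, rfl⟩
  exact (Subgroup.mem_centralizer_singleton_iff.1 (h2 hy)).symm

/-- The commutator subgroup of the Sidki double centralizes the kernel of the map to `G³`. -/
theorem commutator_le_centralizer :
    commutator (SidkiDouble G) ≤ Subgroup.centralizer ((toProd G).ker : Set (SidkiDouble G)) := by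
  set C := Subgroup.centralizer ((toProd G).ker : Set (SidkiDouble G)) with hC
  have hcomm : ∀ g h : G, comm g h ∈ C := fun g h => Subgroup.mem_centralizer_iff.2 fun w hw =>
    (commute_of_mem (comm_mem g h) (ker_toProd_le_diffSubgroup hw)).symm.eq
  have hdiff : ∀ k : G, diff k ∈ C := fun k => Subgroup.mem_centralizer_iff.2 fun w hw =>
    (commute_of_mem (ker_toProd_le_commSubgroup hw) (diff_mem k)).eq
  have : C.Normal := by rw [hC]; infer_instance
  -- Modulo `C` the two copies of `G` coincide and, the `[g, h^ψ]` being trivial, the quotient is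
  -- abelian.
  let q := QuotientGroup.mk' C
  have hlr : ∀ k, q (inl k) = q (inr k) := fun k => by
    have : q (diff k) = 1 := (QuotientGroup.eq_one_iff _).2 (hdiff k)
    rwa [diff, map_mul, map_inv, inv_mul_eq_one] at this
  have hcl : ∀ g h, Commute (q (inl g)) (q (inl h)) := fun g h => by
    have : q (comm g h) = 1 := (QuotientGroup.eq_one_iff _).2 (hcomm g h)
    rw [comm, map_mul, map_mul, map_mul, map_inv, map_inv, ← hlr, ← mul_inv_rev, mul_assoc,
      inv_mul_eq_one] at this
    exact this.symm
  have hrange : ∀ x, ∃ g, q x = q (inl g) := fun x => by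
    induction x using induction_on with
    | one => exact ⟨1, by simp⟩
    | inl_mul k x h =>
      obtain ⟨g, hg⟩ := h
      exact ⟨k * g, by simp only [map_mul, hg]⟩
    | inr_mul k x h =>
      obtain ⟨g, hg⟩ := h
      exact ⟨k * g, by simp only [map_mul, hg, hlr]⟩
  rw [commutator_def, Subgroup.commutator_le]
  intro x _ y _
  obtain ⟨g, hg⟩ := hrange x
  obtain ⟨h, hh⟩ := hrange y
  refine (QuotientGroup.eq_one_iff _).1 ((map_commutatorElement q x y).trans ?_)
  rw [hg, hh, commutatorElement_eq_one_iff_commute]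
  exact hcl g h

end SidkiDouble

/-! ### Descent of the weak Bass trace conjecture -/

section

variable {H Q : Type*} [Group H] [Group Q] {n : ℕ}

theorem kaplanskyTrace_eq_hattoriStallings (A : Matrix (Fin n) (Fin n) (MonoidAlgebra ℂ H)) :
    kaplanskyTrace A = hattoriStallings A (ConjClasses.mk 1) := by
  classical
  rw [kaplanskyTrace, hattoriStallings_apply, Finsupp.finsetSum_apply]
  refine Finset.sum_congr rfl fun i _ => ?_
  rw [Finsupp.mapDomain, Finsupp.sum_apply, Finsupp.sum, Finset.sum_eq_single 1]
  · simp
  · intro h _ hh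
    refine Finsupp.single_eq_of_ne fun h' => hh ?_
    exact isConj_one_right.1 (ConjClasses.mk_eq_mk_iff_isConj.1 h')
  · simp

theorem augmentationTrace_map (φ : H →* Q) (A : Matrix (Fin n) (Fin n) (MonoidAlgebra ℂ H)) :
    augmentationTrace (A.map (MonoidAlgebra.mapDomainRingHom ℂ φ)) = augmentationTrace A := by
  refine Finset.sum_congr rfl fun i _ => ?_
  rw [Matrix.map_apply, MonoidAlgebra.mapDomainRingHom_apply, MonoidAlgebra.coeff_mapDomain]
  exact Finsupp.sum_mapDomain_index (by simp) (by simp)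

theorem kaplanskyTrace_map_of_injective (φ : H →* Q) (hφ : Function.Injective φ)
    (A : Matrix (Fin n) (Fin n) (MonoidAlgebra ℂ H)) :
    kaplanskyTrace (A.map (MonoidAlgebra.mapDomainRingHom ℂ φ)) = kaplanskyTrace A := by
  refine Finset.sum_congr rfl fun i _ => ?_
  rw [Matrix.map_apply, MonoidAlgebra.mapDomainRingHom_apply, MonoidAlgebra.coeff_mapDomain,
    ← map_one φ, Finsupp.mapDomain_apply hφ]

/-- The weak Bass trace conjecture can be checked on finitely generated subgroups. -/
theorem WeakBassTrace.of_fg_subgroups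
    (h : ∀ K : Subgroup H, Group.FG K → WeakBassTrace K) : WeakBassTrace H := by
  classical
  intro n A hA
  let s : Finset H := Finset.univ.biUnion fun i => Finset.univ.biUnion fun j =>
    (A i j).coeff.support
  let K := Subgroup.closure (s : Set H)
  have hs : ∀ i j, ∀ g ∈ (A i j).coeff.support, g ∈ K := fun i j g hg => by
    refine Subgroup.subset_closure ?_
    simp only [s, Finset.coe_biUnion, Set.mem_iUnion, Finset.mem_coe, Finset.mem_univ]
    exact ⟨i, trivial, j, trivial, hg⟩
  obtain ⟨B, hBA⟩ := Matrix.exists_map_eq_of_mem_range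
    (MonoidAlgebra.mapDomainRingHom ℂ K.subtype) A fun i j => by
      rw [← MonoidAlgebra.sum_coeff_single (A i j)]
      refine sum_mem fun g hg => ⟨MonoidAlgebra.single ⟨g, hs i j g hg⟩ ((A i j).coeff g), ?_⟩
      simp
  rw [← hBA] at hA ⊢
  have hB : IsIdempotentElem B := hA.of_map_injective _ (by
    intro x y hxy
    rw [← MonoidAlgebra.coeff_inj] at hxy ⊢
    exact Finsupp.mapDomain_injective K.subtype_injective hxy)
  rw [kaplanskyTrace_map_of_injective _ K.subtype_injective, augmentationTrace_map]
  exact h K (Group.closure_finset_fg s) n B hB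

/-- The weak Bass trace conjecture lifts along a homomorphism of a finitely generated torsion-free
group whose kernel is centralized by the commutator subgroup. -/
theorem WeakBassTrace.of_commute_ker [Group.FG H] (hH : TorsionFreeGroup H) (φ : H →* Q)
    (hφ : ∀ w ∈ φ.ker, ∀ c ∈ commutator H, Commute w c) (hQ : WeakBassTrace Q) :
    WeakBassTrace H := by
  classical
  intro n A hA
  rw [← augmentationTrace_map φ, ← hQ n _ (hA.matrix_map _), kaplanskyTrace_eq_hattoriStallings,
    kaplanskyTrace_eq_hattoriStallings, hattoriStallings_map_mapDomainRingHom, Finsupp.mapDomain,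
    Finsupp.sum_apply, Finsupp.sum, Finset.sum_eq_single (ConjClasses.mk 1)]
  · have : ConjClasses.map φ (ConjClasses.mk 1) = ConjClasses.mk 1 :=
      congrArg ConjClasses.mk (map_one φ)
    rw [this, Finsupp.single_eq_same]
  -- A nontrivial class in the support that dies in `Q` would be that of a kernel element of
  -- infinite order conjugate to its prime powers.
  · intro c hc hc1
    obtain ⟨w, rfl⟩ := ConjClasses.mk_surjective c
    refine Finsupp.single_eq_of_ne fun hw => ?_
    have hw' : φ w = 1 := isConj_one_right.1 (ConjClasses.mk_eq_mk_iff_isConj.1 hw)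
    exact not_exists_conj_prime_pow_of_fg (fun hfin => hc1 (congrArg _ (hH w hfin)))
      (hφ w hw') fun N hN => hA.exists_isConj_prime_pow (Finsupp.mem_support_iff.1 hc) hN
  · intro hc
    rw [Finsupp.notMem_support_iff.1 hc, Finsupp.single_zero, Finsupp.zero_apply]

end

theorem propositionP (G : Type*) [Group G]
    (hX : TorsionFreeGroup (SidkiDouble G))
    (hG : WeakBassTrace (G × G × G)) :
    WeakBassTrace (SidkiDouble G) := by
  refine WeakBassTrace.of_fg_subgroups fun K _ => ?_
  refine WeakBassTrace.of_commute_ker (fun x hx => Subtype.ext (hX _ (K.subtype.isOfFinOrder hx)))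
    ((SidkiDouble.toProd G).comp K.subtype) (fun w hw c hc => ?_) hG
  have hc' : (c : SidkiDouble G) ∈ commutator (SidkiDouble G) := by
    have : (commutator K).map K.subtype ≤ commutator (SidkiDouble G) := by
      rw [commutator_def, commutator_def, Subgroup.map_commutator]
      exact Subgroup.commutator_mono le_top le_top
    exact this ⟨c, hc, rfl⟩
  exact Subtype.ext
    (Subgroup.mem_centralizer_iff.1 (SidkiDouble.commutator_le_centralizer hc') w hw)
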